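/- Let $Z$ be a finite connected bipartite graph, possibly with multiple edges, with an even number of vertices, and let a planar embedding of $Z$ be given. Regard $Z$ as embedded in the sphere, so that the outside face is one of its faces. Count the sides of a face along its boundary walk, so that an edge which has the same face on both of its sides counts as two sides of that face. A signing of $Z$ assigns a weight $+1$ or $-1$ to every edge; it is called flat if every face with $4k$ sides has an odd number of negative sides and every face with $4k+2$ sides has an even number of negative sides ($k \ge 0$ an integer). Then $Z$ has at least one flat signing. -/

import Mathlib

namespace Graph

variable {α β : Type*}

/-- A multigraph is connected if it has a vertex and any two of its vertices are joined by a
sequence of adjacent vertices. -/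
def Connected (G : Graph α β) : Prop :=
  G.vertexSet.Nonempty ∧
    ∀ x ∈ G.vertexSet, ∀ y ∈ G.vertexSet, Relation.ReflTransGen G.Adj x y

/-- A multigraph is bipartite if its vertices can be coloured black and white in such a way that
every edge joins a black and a white vertex. -/
def IsBipartite (G : Graph α β) : Prop :=
  ∃ color : α → Bool, ∀ x y, G.Adj x y → color x ≠ color y

/-- `C` is the edge set of a (simple) cycle of `G`: there are distinct vertices `v 0, …, v n` and
distinct edges `e 0, …, e n`, with `e i` joining `v i` to `v (i + 1)`, indices being read
modulo `n + 1`.  Two parallel edges form a cycle of length two. -/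
def IsCycleEdgeSet (G : Graph α β) (C : Set β) : Prop :=
  ∃ (n : ℕ) (v : Fin (n + 1) → α) (e : Fin (n + 1) → β),
    Function.Injective v ∧ Function.Injective e ∧
      (∀ i, G.IsLink (e i) (v i) (v (i + 1))) ∧ C = Set.range e

/-- A dart (half-edge) of `G`: an edge together with one of its ends, from which it is thought of
as being directed to the other end.  In a graph without loops (in particular, in a bipartite graph)
every edge underlies exactly two darts, one for each direction. -/
def Dart (G : Graph α β) : Type _ := {d : β × α // G.Inc d.1 d.2}

namespace Dart

variable {G : Graph α β}

/-- The edge underlying a dart. -/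
def edge (d : G.Dart) : G.edgeSet := ⟨d.1.1, d.2.edge_mem⟩

/-- The vertex from which a dart starts. -/
def vertex (d : G.Dart) : α := d.1.2

/-- The same edge, with the opposite direction. -/
noncomputable def flip (d : G.Dart) : G.Dart := ⟨(d.1.1, d.2.other), d.2.inc_other⟩

theorem flip_flip (d : G.Dart) : d.flip.flip = d := by
  apply Subtype.ext
  refine Prod.ext rfl ?_
  exact d.flip.2.isLink_other.right_unique d.2.isLink_other.symm

end Dart

/-- The reversal of darts, as a permutation. -/
noncomputable def flipPerm (G : Graph α β) : Equiv.Perm G.Dart where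
  toFun := Dart.flip
  invFun := Dart.flip
  left_inv := Dart.flip_flip
  right_inv := Dart.flip_flip

/-- A rotation system on a loopless multigraph: a cyclic order of the darts around each vertex.
It describes a cellular embedding of a connected graph in a closed oriented surface, in which
`next d` is the dart that follows `d` in the counterclockwise order around the vertex of `d`. -/
structure RotationSystem (G : Graph α β) where
  next : Equiv.Perm G.Dart
  sameCycle_next_iff : ∀ d d' : G.Dart, next.SameCycle d d' ↔ d.vertex = d'.vertex

namespace RotationSystem

variable {G : Graph α β} (R : RotationSystem G)

/-- One step of the walk along the boundary of a face: go along the dart `d` to its other end, and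
leave that vertex by the dart which is next in the rotation there. -/
noncomputable def facePerm : Equiv.Perm G.Dart := R.next * G.flipPerm

/-- The faces of the embedding correspond to their boundary walks, i.e. to the cycles of
`facePerm`. -/
def Face : Type _ := Quotient (Equiv.Perm.SameCycle.setoid R.facePerm)

/-- The face whose boundary walk runs along the dart `d`.  The face on the other side of the edge
of `d` is `R.face d.flip`. -/
noncomputable def face (d : G.Dart) : R.Face := Quotient.mk _ d

/-- The sides of a face, as the darts of its boundary walk.  An edge which has the face `F` on both
of its sides counts as two sides of `F`. -/
def sides (F : R.Face) : Set G.Dart := {d | R.face d = F}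

/-- Two faces are neighbours off `C` if they lie on the two sides of some edge not in `C`. -/
def NeighboursOff (C : Set β) (F F' : R.Face) : Prop :=
  ∃ d : G.Dart, (d.edge : β) ∉ C ∧ R.face d = F ∧ R.face d.flip = F'

/-- `C` separates the surface: there are two faces such that one cannot pass from the one to the
other by crossing only edges that are not in `C`. -/
def Separates (C : Set β) : Prop :=
  ∃ F F' : R.Face, ¬ Relation.ReflTransGen (R.NeighboursOff C) F F'

/-- A signing (a choice of weight `1` or `-1` for every edge) is flat if every face with `4 k` sides
has an odd number of negative sides, and every face with `4 k + 2` sides has an even number of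
negative sides. -/
def IsFlat (s : G.edgeSet → ℤˣ) : Prop :=
  ∀ F : R.Face,
    ((∃ k : ℕ, (R.sides F).ncard = 4 * k) → Odd {d ∈ R.sides F | s d.edge = -1}.ncard) ∧
    ((∃ k : ℕ, (R.sides F).ncard = 4 * k + 2) → Even {d ∈ R.sides F | s d.edge = -1}.ncard)

end RotationSystem

/-- A planar embedding of a connected loopless multigraph with at least one edge, up to
homeomorphism: a cellular embedding in a closed oriented surface which is a sphere, i.e. in which
the Jordan curve theorem holds: every cycle of the graph separates the surface.  The outside face
of a drawing in the plane is one of the faces. -/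
structure PlanarEmbedding (G : Graph α β) extends RotationSystem G where
  separates_of_isCycleEdgeSet : ∀ C, G.IsCycleEdgeSet C → toRotationSystem.Separates C

end Graph

/-! Encode a signing as a vector over `ZMod 2`, with 1 on the negative edges. Faces have even
length, so flatness is a linear system: the sides of each face `F` must sum to `1 + |F| / 2`. The
indicator of an edge contributes the indicators of the two faces beside it; as the dual graph is
connected (`face_reflTransGen`), every right-hand side with zero total is attained
(`exists_forall_sum_eq`). Here the total is the number of faces plus the number of edges, which by
Euler's formula has the parity of the number of vertices. Modulo two, Euler's formula is
multiplicativity of the sign in `facePerm = next * flipPerm`: the cycles of the three permutations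
are the faces, the vertices and the edges. -/

/-- If the fibres of the surjection `f` are the orbits of `σ`, then the sign of `σ` is determined by
the parities of the numbers of points and of orbits. -/
theorem Equiv.Perm.sign_eq_neg_one_pow_of_sameCycle_iff {D X : Type*} [Fintype D] [DecidableEq D]
    [Fintype X] (σ : Equiv.Perm D) (f : D → X) (hf : Function.Surjective f)
    (h : ∀ d d', σ.SameCycle d d' ↔ f d = f d') :
    Equiv.Perm.sign σ = (-1) ^ (Fintype.card D + Fintype.card X) := by
  classical
  have hcycle : σ.cycleType.card = (σ.support.image f).card := by
    have himage : σ.cycleFactorsFinset = σ.support.image σ.cycleOf := by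
      ext c
      simp only [Finset.mem_image]
      constructor
      · intro hc
        obtain ⟨x, hx⟩ := (Equiv.Perm.mem_cycleFactorsFinset_iff.mp hc).1.nonempty_support
        refine ⟨x, Equiv.Perm.mem_cycleFactorsFinset_support_le hc hx, ?_⟩
        exact (Equiv.Perm.cycle_is_cycleOf hx hc).symm
      · rintro ⟨x, hx, rfl⟩
        exact Equiv.Perm.cycleOf_mem_cycleFactorsFinset_iff.mpr hx
    have hcard : σ.cycleType.card = σ.cycleFactorsFinset.card := by
      simp [Equiv.Perm.cycleType_def]
    rw [hcard, himage]
    have key : ∀ x ∈ σ.support, ∀ y ∈ σ.support, σ.cycleOf x = σ.cycleOf y ↔ f x = f y :=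
      fun x hx y hy => by
        rw [← h, Equiv.Perm.sameCycle_iff_cycleOf_eq_of_mem_support hx hy]
    refine le_antisymm ?_ ?_
    · refine Finset.card_le_card_of_surjOn (fun z => σ.cycleOf (Function.surjInv hf z)) ?_
      rintro c hc
      obtain ⟨x, hx, rfl⟩ := Finset.mem_image.mp hc
      refine ⟨f x, Finset.mem_coe.mpr (Finset.mem_image_of_mem f hx), ?_⟩
      exact ((h _ _).mpr (Function.surjInv_eq hf (f x))).cycleOf_eq
    · refine Finset.card_le_card_of_injOn (fun z => σ.cycleOf (Function.surjInv hf z)) ?_ ?_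
      · rintro z hz
        obtain ⟨x, hx, rfl⟩ := Finset.mem_image.mp hz
        have hs : σ.SameCycle (Function.surjInv hf (f x)) x :=
          (h _ _).mpr (Function.surjInv_eq hf (f x))
        exact Finset.mem_coe.mpr (Finset.mem_image.mpr ⟨x, hx, hs.cycleOf_eq.symm⟩)
      · rintro z hz w hw hzw
        obtain ⟨x, hx, rfl⟩ := Finset.mem_image.mp hz
        obtain ⟨y, hy, rfl⟩ := Finset.mem_image.mp hw
        have hs : ∀ x, σ.SameCycle (Function.surjInv hf (f x)) x := fun x =>
          (h _ _).mpr (Function.surjInv_eq hf (f x))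
        rw [← key x hx y hy, ← (hs x).cycleOf_eq, ← (hs y).cycleOf_eq]
        exact hzw
  have hfixed : (σ.supportᶜ.image f).card = σ.supportᶜ.card := by
    refine Finset.card_image_of_injOn fun x hx y _ hxy => ?_
    obtain ⟨n, hn⟩ := (h x y).mpr hxy
    have hx' : σ x = x := by simpa using hx
    rw [← hn]
    exact (Equiv.Perm.zpow_apply_eq_self_of_apply_eq_self hx' n).symm
  have hdisj : _root_.Disjoint (σ.support.image f) (σ.supportᶜ.image f) := by
    rw [Finset.disjoint_left]
    rintro z hz hz'
    obtain ⟨x, hx, rfl⟩ := Finset.mem_image.mp hz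
    obtain ⟨y, hy, hyx⟩ := Finset.mem_image.mp hz'
    obtain ⟨n, hn⟩ := (h y x).mpr hyx
    have hy' : σ y = y := by simpa using hy
    rw [Equiv.Perm.zpow_apply_eq_self_of_apply_eq_self hy' n] at hn
    subst hn
    exact (Finset.mem_compl.mp hy) hx
  have hX : Fintype.card X = (σ.support.image f).card + σ.supportᶜ.card := by
    rw [← hfixed, ← Finset.card_union_of_disjoint hdisj, ← Finset.image_union,
      Finset.union_compl, Finset.image_univ_of_surjective hf, Finset.card_univ]
  have hD : Fintype.card D = σ.support.card + σ.supportᶜ.card := by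
    rw [Finset.card_add_card_compl]
  -- `cycleType` omits fixed points; each of them is one point and one orbit, so they contribute an
  -- even amount to the exponent.
  rw [Equiv.Perm.sign_of_cycleType, Equiv.Perm.sum_cycleType, hcycle, hX, hD,
    show σ.support.card + σ.supportᶜ.card + ((σ.support.image f).card + σ.supportᶜ.card)
      = (σ.support.card + (σ.support.image f).card) + 2 * σ.supportᶜ.card by ring,
    pow_add _ _ (2 * _), pow_mul]
  simp

/-! ### Darts, faces and parity -/

namespace Graph

variable {α β : Type*} {G : Graph α β}

theorem finite_dart (hV : G.vertexSet.Finite) (hE : G.edgeSet.Finite) : Finite G.Dart := by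
  have := hV.to_subtype
  have := hE.to_subtype
  refine Finite.of_injective
    (fun d : G.Dart => ((⟨d.1.1, d.2.edge_mem⟩, ⟨d.1.2, d.2.vertex_mem⟩) :
      G.edgeSet × G.vertexSet)) fun d d' h => ?_
  simp only [Prod.mk.injEq, Subtype.mk.injEq] at h
  exact Subtype.ext (Prod.ext h.1 h.2)

namespace Dart

theorem isLink (d : G.Dart) : G.IsLink d.edge d.vertex d.flip.vertex := d.2.isLink_other

theorem edge_eq_edge_iff (d d' : G.Dart) : d.edge = d'.edge ↔ d = d' ∨ d = d'.flip := by
  constructor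
  · intro h
    have he : d.1.1 = d'.1.1 := congrArg Subtype.val h
    have hl : G.IsLink d.1.1 d'.vertex d'.flip.vertex := he ▸ d'.isLink
    rcases d.2.eq_or_eq_of_isLink hl with h | h
    · exact Or.inl (Subtype.ext (Prod.ext he h))
    · exact Or.inr (Subtype.ext (Prod.ext he h))
  · rintro (rfl | rfl) <;> rfl

theorem edge_surjective : Function.Surjective (edge : G.Dart → G.edgeSet) := by
  rintro ⟨e, he⟩
  obtain ⟨x, y, h⟩ := G.exists_isLink_of_mem_edgeSet he
  exact ⟨⟨(e, x), h.inc_left⟩, rfl⟩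

theorem flipPerm_sameCycle_iff (d d' : G.Dart) :
    G.flipPerm.SameCycle d d' ↔ d.edge = d'.edge := by
  constructor
  · rintro ⟨n, rfl⟩
    induction n with
    | zero => rfl
    | succ n ih => rw [ih, add_comm, zpow_add, zpow_one, Equiv.Perm.mul_apply]; rfl
    | pred n ih =>
      rw [ih, sub_eq_add_neg, add_comm, zpow_add, zpow_neg_one, Equiv.Perm.mul_apply]; rfl
  · rw [edge_eq_edge_iff]
    rintro (rfl | rfl)
    · exact Equiv.Perm.SameCycle.refl _ _
    · exact ⟨1, flip_flip d'⟩

theorem flip_ne {color : α → Bool} (hc : ∀ x y, G.Adj x y → color x ≠ color y) (d : G.Dart) :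
    d.flip ≠ d := fun h => hc _ _ d.isLink.adj (by rw [h])

end Dart

/-- Evenness excludes the one-vertex graph, whose vertex would be no cycle of `next` and so escape
the count by signs. -/
theorem exists_dart_of_connected (hconn : G.Connected) (heven : Even G.vertexSet.ncard)
    {x : α} (hx : x ∈ G.vertexSet) : ∃ d : G.Dart, d.vertex = x := by
  have hne : ∃ y ∈ G.vertexSet, y ≠ x := by
    by_contra! h
    have : G.vertexSet = {x} := Set.eq_singleton_iff_unique_mem.mpr ⟨hx, h⟩
    rw [this, Set.ncard_singleton] at heven
    exact absurd heven (by decide)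
  obtain ⟨y, hy, hyx⟩ := hne
  rcases (hconn.2 x hx y hy).cases_head with h | ⟨z, ⟨e, he⟩, -⟩
  · exact absurd h.symm hyx
  · exact ⟨⟨(e, x), he.inc_left⟩, rfl⟩

namespace RotationSystem

variable (R : RotationSystem G)

theorem face_eq_face_iff (d d' : G.Dart) : R.face d = R.face d' ↔ R.facePerm.SameCycle d d' :=
  Quotient.eq (r := Equiv.Perm.SameCycle.setoid R.facePerm)

theorem face_surjective : Function.Surjective R.face := Quotient.mk_surjective

theorem face_facePerm (d : G.Dart) : R.face (R.facePerm d) = R.face d :=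
  (R.face_eq_face_iff _ _).mpr (Equiv.Perm.sameCycle_apply_left.mpr (Equiv.Perm.SameCycle.refl _ _))

/-- Since `R.next d = R.facePerm d.flip`, turning about a vertex crosses one edge at a time. -/
theorem face_next (d : G.Dart) : R.face (R.next d) = R.face d.flip := by
  have h := R.face_facePerm d.flip
  rw [← h]
  exact congrArg (fun x => R.face (R.next x)) d.flip_flip.symm

theorem vertex_next (d : G.Dart) : (R.next d).vertex = d.vertex :=
  (R.sameCycle_next_iff _ _).mp
    (Equiv.Perm.sameCycle_apply_left.mpr (Equiv.Perm.SameCycle.refl _ _))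

theorem vertex_facePerm (d : G.Dart) : (R.facePerm d).vertex = d.flip.vertex :=
  R.vertex_next d.flip

/-- Euler's formula modulo two. -/
theorem even_card_vertexSet_add_card_edgeSet_add_card_face [Fintype G.Dart] [Fintype G.vertexSet]
    [Fintype G.edgeSet] [Fintype R.Face] (hsurj : ∀ x ∈ G.vertexSet, ∃ d : G.Dart, d.vertex = x) :
    Even (Fintype.card G.vertexSet + Fintype.card G.edgeSet + Fintype.card R.Face +
      Fintype.card G.Dart) := by
  classical
  have hnext := R.next.sign_eq_neg_one_pow_of_sameCycle_iff
    (fun d => (⟨d.vertex, d.2.vertex_mem⟩ : G.vertexSet))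
    (fun ⟨x, hx⟩ => (hsurj x hx).imp fun d hd => Subtype.ext hd)
    (fun d d' => (R.sameCycle_next_iff d d').trans Subtype.mk_eq_mk.symm)
  have hflip := G.flipPerm.sign_eq_neg_one_pow_of_sameCycle_iff Dart.edge
    Dart.edge_surjective Dart.flipPerm_sameCycle_iff
  have hface := R.facePerm.sign_eq_neg_one_pow_of_sameCycle_iff R.face R.face_surjective
    (fun d d' => (R.face_eq_face_iff d d').symm)
  rw [facePerm, Equiv.Perm.sign_mul, hnext, hflip, ← pow_add] at hface
  have hone : ((-1 : ℤˣ)) ^ ((Fintype.card G.Dart + Fintype.card G.vertexSet +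
      (Fintype.card G.Dart + Fintype.card G.edgeSet)) +
      (Fintype.card G.Dart + Fintype.card R.Face)) = 1 := by
    rw [pow_add _ _ (Fintype.card G.Dart + Fintype.card R.Face), hface, ← mul_pow]
    simp
  rw [neg_one_pow_eq_one_iff_even (by decide)] at hone
  grind

/-- The faces of a connected graph are connected by crossing edges. -/
theorem face_reflTransGen (hconn : G.Connected) {r : R.Face → R.Face → Prop} (hr : Equivalence r)
    (hflip : ∀ d, r (R.face d) (R.face d.flip)) (d d' : G.Dart) : r (R.face d) (R.face d') := by
  have hnext : ∀ d, r (R.face d) (R.face (R.next d)) := fun d => R.face_next d ▸ hflip d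
  have hvertex : ∀ d d' : G.Dart, d.vertex = d'.vertex → r (R.face d) (R.face d') := by
    intro d d' h
    obtain ⟨n, rfl⟩ := (R.sameCycle_next_iff d d').mpr h
    clear h
    induction n with
    | zero => exact hr.refl _
    | succ n ih =>
      rw [add_comm, zpow_add, zpow_one, Equiv.Perm.mul_apply]
      exact hr.trans ih (hnext _)
    | pred n ih =>
      rw [sub_eq_add_neg, add_comm, zpow_add, zpow_neg_one, Equiv.Perm.mul_apply]
      refine hr.trans ih (hr.symm ?_)
      have := hnext (R.next⁻¹ ((R.next ^ (-(n : ℤ))) d))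
      rwa [← Equiv.Perm.mul_apply R.next, mul_inv_cancel, Equiv.Perm.one_apply] at this
  have hpath : ∀ y, Relation.ReflTransGen G.Adj d.vertex y →
      ∀ d' : G.Dart, d'.vertex = y → r (R.face d) (R.face d') := by
    intro y h
    induction h with
    | refl => exact fun d' h => hvertex _ _ h.symm
    | tail _ hadj ih =>
      obtain ⟨e, he⟩ := hadj
      intro d' hd'
      let c : G.Dart := ⟨(e, _), he.inc_left⟩
      have hc : c.flip.vertex = d'.vertex := by
        rw [hd']
        exact c.isLink.right_unique he
      exact hr.trans (ih c rfl) (hr.trans (hflip c) (hvertex _ _ hc))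
  exact hpath _ (hconn.2 _ d.2.vertex_mem _ d'.2.vertex_mem) d' rfl

/-- `facePerm` preserves the face and switches the colour of the starting vertex, so it matches the
sides starting at black vertices with those starting at white ones. -/
theorem even_card_filter_face_eq [Fintype G.Dart] [DecidableEq R.Face] (hbip : G.IsBipartite)
    (F : R.Face) : Even (Finset.univ.filter fun d => R.face d = F).card := by
  obtain ⟨color, hc⟩ := hbip
  have hcard : ((Finset.univ.filter fun d => R.face d = F).filter
        fun d => color d.vertex = true).card =
      ((Finset.univ.filter fun d => R.face d = F).filter
        fun d => ¬ color d.vertex = true).card := by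
    refine Finset.card_equiv R.facePerm fun d => ?_
    have h := hc _ _ d.isLink.adj
    simp only [Finset.mem_filter, Finset.mem_univ, true_and, R.face_facePerm, R.vertex_facePerm]
    cases h1 : color d.vertex <;> cases h2 : color d.flip.vertex <;> simp_all
  rw [← Finset.card_filter_add_card_filter_not (fun d : G.Dart => color d.vertex = true), hcard]
  exact Even.add_self _

/-- The number of negative sides of each face may be prescribed modulo two, as long as the sum of
the prescribed values vanishes. -/
theorem exists_forall_sum_eq [Fintype G.Dart] [Fintype R.Face] [DecidableEq R.Face]
    (hconn : G.Connected) (hbip : G.IsBipartite) (b : R.Face → ZMod 2) (hb : ∑ F, b F = 0) :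
    ∃ x : G.edgeSet → ZMod 2,
      ∀ F, ∑ d ∈ Finset.univ.filter (fun d => R.face d = F), x d.edge = b F := by
  classical
  obtain ⟨color, hc⟩ := hbip
  let Φ : (G.edgeSet → ZMod 2) →ₗ[ZMod 2] (R.Face → ZMod 2) :=
    ∑ d : G.Dart, (LinearMap.single (ZMod 2) (fun _ : R.Face => ZMod 2) (R.face d)).comp
      (LinearMap.proj d.edge)
  have hΦ : ∀ x F, Φ x F = ∑ d ∈ Finset.univ.filter (fun d => R.face d = F), x d.edge := by
    intro x F
    simp only [Φ, LinearMap.sum_apply, Finset.sum_apply, Finset.sum_filter, LinearMap.comp_apply,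
      LinearMap.proj_apply, LinearMap.single_apply, Pi.single_apply]
    exact Finset.sum_congr rfl fun d _ => by simp only [eq_comm]
  have hsub : ∀ F F', (Pi.single F 1 - Pi.single F' 1 : R.Face → ZMod 2) ∈ LinearMap.range Φ := by
    intro F F'
    obtain ⟨d, rfl⟩ := R.face_surjective F
    obtain ⟨d', rfl⟩ := R.face_surjective F'
    refine R.face_reflTransGen hconn
      (r := fun F F' => (Pi.single F 1 - Pi.single F' 1 : R.Face → ZMod 2) ∈ LinearMap.range Φ)
      ⟨fun F => ?_, fun {F F'} h => ?_, fun {F F' F''} h h' => ?_⟩ (fun d => ?_) d d'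
    · rw [sub_self]; exact zero_mem _
    · rw [← neg_sub]; exact neg_mem h
    · rw [← sub_add_sub_cancel]; exact add_mem h h'
    -- Signs vanish modulo two, so the difference is the sum over the two darts of this edge, even
    -- if both lie on one face.
    · refine ⟨Pi.single d.edge 1, ?_⟩
      have hpair : (Finset.univ.filter fun c : G.Dart => c.edge = d.edge) = {d, d.flip} := by
        ext c
        simp [Dart.edge_eq_edge_iff]
      rw [sub_eq_add_neg, ← Pi.single_neg, ZMod.neg_eq_self_mod_two, ← Finset.sum_pair (f := fun c => (Pi.single (R.face c) 1 :
        R.Face → ZMod 2)) (Dart.flip_ne hc d).symm, ← hpair, Finset.sum_filter]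
      simp only [Φ, LinearMap.sum_apply, LinearMap.comp_apply, LinearMap.proj_apply,
        LinearMap.coe_single]
      refine Finset.sum_congr rfl fun c _ => ?_
      by_cases h : c.edge = d.edge <;> simp [h]
  have hmem : b ∈ LinearMap.range Φ := by
    rcases isEmpty_or_nonempty R.Face with h | ⟨⟨F₀⟩⟩
    · rw [Subsingleton.elim b 0]
      exact zero_mem _
    -- The terms at `F₀` cancel because `b` has zero total.
    · have hexp : b = ∑ F, b F • (Pi.single F 1 - Pi.single F₀ 1 : R.Face → ZMod 2) := by
        simp only [smul_sub, Finset.sum_sub_distrib, ← Finset.sum_smul, hb, zero_smul, sub_zero]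
        exact pi_eq_sum_univ' b
      rw [hexp]
      exact sum_mem fun F _ => Submodule.smul_mem _ _ (hsub F F₀)
  obtain ⟨x, hx⟩ := hmem
  exact ⟨x, fun F => by rw [← hΦ, hx]⟩

end RotationSystem

end Graph

theorem mainTheorem5 {α β : Type*} (G : Graph α β)
    (hV : G.vertexSet.Finite) (hE : G.edgeSet.Finite)
    (hconn : G.Connected) (hbip : G.IsBipartite) (heven : Even G.vertexSet.ncard)
    (P : G.PlanarEmbedding) :
    ∃ s : G.edgeSet → ℤˣ, P.IsFlat s := by
  classical
  have := Graph.finite_dart hV hE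
  have := Fintype.ofFinite G.Dart
  have := hV.fintype
  have := hE.fintype
  have : Finite P.Face := Finite.of_surjective _ P.face_surjective
  have := Fintype.ofFinite P.Face
  let S : P.Face → Finset G.Dart := fun F => Finset.univ.filter fun d => P.face d = F
  have hS : ∀ F, Even (S F).card := P.even_card_filter_face_eq hbip
  have hdart : Fintype.card G.Dart = 2 * Fintype.card G.edgeSet := by
    obtain ⟨color, hc⟩ := hbip
    rw [← Finset.card_univ, Finset.card_eq_sum_card_fiberwise (f := Graph.Dart.edge)
      (t := Finset.univ) (fun _ _ => Finset.mem_coe.mpr (Finset.mem_univ _)),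
      Finset.sum_const_nat (m := 2), Finset.card_univ, mul_comm]
    intro e _
    obtain ⟨d, rfl⟩ := Graph.Dart.edge_surjective e
    rw [← Finset.card_pair (Graph.Dart.flip_ne hc d).symm]
    congr 1
    ext c
    simp [Graph.Dart.edge_eq_edge_iff]
  have hsum : ∑ F, (S F).card / 2 = Fintype.card G.edgeSet := by
    have h : Fintype.card G.Dart = ∑ F, (S F).card := by
      rw [← Finset.card_univ, Finset.card_eq_sum_card_fiberwise (f := P.face)
        (t := Finset.univ) (fun _ _ => Finset.mem_coe.mpr (Finset.mem_univ _))]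
    have h' : ∑ F, (S F).card = 2 * ∑ F, (S F).card / 2 := by
      rw [Finset.mul_sum]
      exact Finset.sum_congr rfl fun F _ => (Nat.two_mul_div_two_of_even (hS F)).symm
    omega
  have hEuler := P.even_card_vertexSet_add_card_edgeSet_add_card_face
    fun x hx => Graph.exists_dart_of_connected hconn heven hx
  have heven' : Even (Fintype.card G.vertexSet) := by
    rwa [← Nat.card_eq_fintype_card, Nat.card_coe_set_eq]
  -- Half the length of a face, summed over all faces, counts each edge once.
  have hb : ∑ F, ((1 + (S F).card / 2 : ℕ) : ZMod 2) = 0 := by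
    rw [← Nat.cast_sum, ZMod.natCast_eq_zero_iff_even, Finset.sum_add_distrib, hsum,
      Finset.sum_const, Finset.card_univ, smul_eq_mul, mul_one]
    grind
  obtain ⟨x, hx⟩ := P.exists_forall_sum_eq hconn hbip _ hb
  refine ⟨fun e => if x e = 1 then -1 else 1, fun F => ?_⟩
  have hsides : (P.sides F).ncard = (S F).card := by
    rw [← Set.ncard_coe_finset]
    congr 1
    ext d
    simp [S, Graph.RotationSystem.sides]
  have hneg : ({d ∈ P.sides F | (if x d.edge = 1 then (-1 : ℤˣ) else 1) = -1}.ncard : ZMod 2) =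
      ((1 + (S F).card / 2 : ℕ) : ZMod 2) := by
    have hset : {d ∈ P.sides F | (if x d.edge = 1 then (-1 : ℤˣ) else 1) = -1} =
        ((S F).filter fun d => x d.edge = 1 : Finset G.Dart) := by
      ext d
      by_cases h : x d.edge = 1 <;> simp [S, Graph.RotationSystem.sides, h]
    rw [hset, Set.ncard_coe_finset, ← hx F, Finset.card_filter, Nat.cast_sum]
    refine Finset.sum_congr rfl fun d _ => ?_
    generalize x d.edge = a
    revert a
    decide
  -- The prescribed value is `1 + 2 * k` for length `4 * k`, and `2 * k + 2` for length `4 * k + 2`.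
  rw [hsides]
  constructor
  · rintro ⟨k, hk⟩
    rw [← ZMod.natCast_eq_one_iff_odd, hneg, ZMod.natCast_eq_one_iff_odd, hk]
    exact ⟨k, by omega⟩
  · rintro ⟨k, hk⟩
    rw [← ZMod.natCast_eq_zero_iff_even, hneg, ZMod.natCast_eq_zero_iff_even, hk]
    exact ⟨k + 1, by omega⟩
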